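/- Let $n \ge 3$ and let $\mathbb S^{n-1}$ be the unit sphere in $\mathbb R^n$. A finite non-empty set $Y \subset \mathbb S^{n-1}$ is called a spherical design of harmonic index $t$ if $\sum_{y\in Y} f(y)=0$ for every real homogeneous harmonic polynomial $f$ of degree $t$ in $n$ variables. Let $Q_{n,k}$ be the Gegenbauer polynomials, given by $Q_{n,0}(x)=1$, $Q_{n,1}(x)=nx$ and $$\lambda_{k+1}Q_{n,k+1}(x)=x\,Q_{n,k}(x)-(1-\lambda_{k-1})\,Q_{n,k-1}(x)\quad (k\ge 1),\qquad \lambda_k=\frac{k}{n+2k-2},$$ and put $$c_{n,t}=-\min_{-1\le x\le 1}Q_{n,t}(x),\qquad b_{n,t}=1+\frac{Q_{n,t}(1)}{c_{n,t}}.$$ A spherical design $Y\subset\mathbb S^{n-1}$ of harmonic index $t$ is called tight if $|Y|=b_{n,t}$. Then: 1. there is no tight spherical design of harmonic index $8$ on $\mathbb S^{n-1}$; 2. if $n\ge 20$, then $b_{n,8}>\frac{n(n+1)}{2}$; 3. if $3\le n\le 19$, then $b_{n,8}$ is not an integer. -/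

import Mathlib

open Polynomial

noncomputable section

/-- The Gegenbauer polynomials `Q_{n,k}`, in the recursive definition of Delsarte, Goethals and
Seidel: `Q_{n,0} = 1`, `Q_{n,1} = n x` and
`λ_{k+1} Q_{n,k+1} = x Q_{n,k} - (1 - λ_{k-1}) Q_{n,k-1}`, where `λ_k = k / (n + 2k - 2)`.
They are normalized by `Q_{n,k}(1) = dim Harm_k^n`. Below, the index `k` of the recursion is
shifted by one, so `λ_{k+2} = (k+2) / (n + 2k + 2)` and `λ_k = k / (n + 2k - 2)`. -/
def gegenbauerQ (n : ℕ) : ℕ → ℝ[X]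
  | 0 => 1
  | 1 => C (n : ℝ) * X
  | k + 2 =>
      C (((k : ℝ) + 2) / ((n : ℝ) + 2 * k + 2))⁻¹ *
        (X * gegenbauerQ n (k + 1) -
          C (1 - (k : ℝ) / ((n : ℝ) + 2 * k - 2)) * gegenbauerQ n k)

/-- `c_{n,t} = - min Q_{n,t}(x)`, the minimum being over `-1 ≤ x ≤ 1`. -/
def harmonicIndexC (n t : ℕ) : ℝ :=
  -sInf ((fun x : ℝ => (gegenbauerQ n t).eval x) '' Set.Icc (-1) 1)

/-- The Fisher type lower bound `b_{n,t} = 1 + Q_{n,t}(1) / c_{n,t}`. -/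
def harmonicIndexB (n t : ℕ) : ℝ :=
  1 + (gegenbauerQ n t).eval 1 / harmonicIndexC n t

/-- `f` belongs to `Harm_t^n`: it is a real homogeneous polynomial of degree `t` in `n`
indeterminates whose Laplacian is zero. -/
def IsHarmonicForm {n : ℕ} (t : ℕ) (f : MvPolynomial (Fin n) ℝ) : Prop :=
  f.IsHomogeneous t ∧ ∑ i, MvPolynomial.pderiv i (MvPolynomial.pderiv i f) = 0

/-- A finite non-empty subset `Y` of the unit sphere `S^{n-1}` is a spherical design of harmonic
index `t` if `∑_{y ∈ Y} f(y) = 0` for every `f` in `Harm_t^n`. -/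
structure IsHarmonicIndexDesign {n : ℕ} (t : ℕ) (Y : Finset (EuclideanSpace ℝ (Fin n))) :
    Prop where
  nonempty : Y.Nonempty
  subset_sphere : ∀ y ∈ Y, y ∈ Metric.sphere (0 : EuclideanSpace ℝ (Fin n)) 1
  sum_eq_zero : ∀ f : MvPolynomial (Fin n) ℝ, IsHarmonicForm t f →
    ∑ y ∈ Y, MvPolynomial.eval (fun i => y i) f = 0

/-- A spherical design of harmonic index `t` is tight if `|Y| = b_{n,t}`. -/
def IsTightHarmonicIndexDesign {n : ℕ} (t : ℕ) (Y : Finset (EuclideanSpace ℝ (Fin n))) : Prop :=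
  IsHarmonicIndexDesign t Y ∧ (Y.card : ℝ) = harmonicIndexB n t

end

/-! `Q_{n,8}(x)` is a positive multiple of a quartic `G(x²)`, so `b = 1 + G(1) / (-min G)` with the
minimum over `[0, 1]`, and bounds on `min G` become bounds on `b`. Sum-of-squares certificates and
sample points give `b > n(n+1)/2` for `n ≥ 20` and trap `b` between consecutive integers for `n ≤
19`, where tightness is therefore impossible.

For `n ≥ 20`, sum the zonal harmonic with pole `x ∈ Y` over a tight `Y`: the value `|Y| = b` forces
`G(⟨z, x⟩²) = min G` for every `z ≠ x`. The minimiser is unique (`gegenbauerOctic_isMinOn_unique`),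
so `Y` spans equiangular lines and `|Y| ≤ n(n+1)/2`, a contradiction. -/

/-- The quartic in `u = x²` to which `Q_{n,8}(x)` is proportional. -/
def gegenbauerOctic (n u : ℝ) : ℝ :=
  (n + 12) * (n + 10) * (n + 8) * (n + 6) * u ^ 4 - 28 * (n + 10) * (n + 8) * (n + 6) * u ^ 3
    + 210 * (n + 8) * (n + 6) * u ^ 2 - 420 * (n + 6) * u + 105

lemma gegenbauerOctic_one (n : ℝ) :
    gegenbauerOctic n 1 = (n - 1) * (n + 1) * (n + 3) * (n + 5) := by
  unfold gegenbauerOctic; ring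

lemma eval_gegenbauerQ_add_two (n k : ℕ) (x : ℝ) :
    (gegenbauerQ n (k + 2)).eval x = ((n : ℝ) + 2 * k + 2) / (k + 2) *
      (x * (gegenbauerQ n (k + 1)).eval x -
        (1 - (k : ℝ) / ((n : ℝ) + 2 * k - 2)) * (gegenbauerQ n k).eval x) := by
  rw [gegenbauerQ]
  simp only [eval_mul, eval_sub, eval_C, eval_X, inv_div]

lemma eval_gegenbauerQ_eight (n : ℕ) (hn : 3 ≤ n) (x : ℝ) :
    (gegenbauerQ n 8).eval x = (n : ℝ) * (n + 2) * (n + 4) * (n + 14) / 40320 *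
      gegenbauerOctic n (x ^ 2) := by
  have hn' : (3 : ℝ) ≤ n := by exact_mod_cast hn
  have q0 : (gegenbauerQ n 0).eval x = 1 := by simp [gegenbauerQ]
  have q1 : (gegenbauerQ n 1).eval x = n * x := by simp [gegenbauerQ]
  have q2 : (gegenbauerQ n 2).eval x = (n + 2) / 2 * (n * x ^ 2 - 1) := by
    rw [eval_gegenbauerQ_add_two, q0, q1]; norm_num; left; ring
  have q3 : (gegenbauerQ n 3).eval x = n * (n + 4) / 6 * ((n + 2) * x ^ 3 - 3 * x) := by
    rw [eval_gegenbauerQ_add_two n 1, q2, q1]; push_cast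
    rw [show (n : ℝ) + 2 * 1 - 2 = n by ring]
    field_simp; ring
  have q4 : (gegenbauerQ n 4).eval x =
      n * (n + 6) / 24 * ((n + 4) * (n + 2) * x ^ 4 - 6 * (n + 2) * x ^ 2 + 3) := by
    rw [eval_gegenbauerQ_add_two n 2, q3, q2]; push_cast
    rw [show (n : ℝ) + 2 * 2 - 2 = n + 2 by ring]
    field_simp; ring
  have q5 : (gegenbauerQ n 5).eval x = n * (n + 2) * (n + 8) / 120 *
      ((n + 6) * (n + 4) * x ^ 5 - 10 * (n + 4) * x ^ 3 + 15 * x) := by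
    rw [eval_gegenbauerQ_add_two n 3, q4, q3]; push_cast
    rw [show (n : ℝ) + 2 * 3 - 2 = n + 4 by ring]
    field_simp; ring
  have q6 : (gegenbauerQ n 6).eval x = n * (n + 2) * (n + 10) / 720 *
      ((n + 8) * (n + 6) * (n + 4) * x ^ 6 - 15 * (n + 6) * (n + 4) * x ^ 4
        + 45 * (n + 4) * x ^ 2 - 15) := by
    rw [eval_gegenbauerQ_add_two n 4, q5, q4]; push_cast
    rw [show (n : ℝ) + 2 * 4 - 2 = n + 6 by ring]
    field_simp; ring
  have q7 : (gegenbauerQ n 7).eval x = n * (n + 2) * (n + 4) * (n + 12) / 5040 *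
      ((n + 10) * (n + 8) * (n + 6) * x ^ 7 - 21 * (n + 8) * (n + 6) * x ^ 5
        + 105 * (n + 6) * x ^ 3 - 105 * x) := by
    rw [eval_gegenbauerQ_add_two n 5, q6, q5]; push_cast
    rw [show (n : ℝ) + 2 * 5 - 2 = n + 8 by ring]
    field_simp; ring
  rw [eval_gegenbauerQ_add_two n 6, q7, q6, gegenbauerOctic]; push_cast
  rw [show (n : ℝ) + 2 * 6 - 2 = n + 10 by ring]
  field_simp; ring

/-! ### Sum-of-squares lower bounds for the quartic -/

/-- Completing the square with a free shift `q`, `4a` times the quartic is `(2au² + bu + 2aq)²` plus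
a quadratic in `u` with leading coefficient `A`; `hD` says that its discriminant is negative. -/
lemma quartic_pos {a b c d e q : ℝ} (ha : 0 < a) (hA : 0 < 4 * a * c - b ^ 2 - 8 * a ^ 2 * q)
    (hD : a * (d - b * q) ^ 2 < (4 * a * c - b ^ 2 - 8 * a ^ 2 * q) * (e - a * q ^ 2)) (u : ℝ) :
    0 < a * u ^ 4 + b * u ^ 3 + c * u ^ 2 + d * u + e := by
  set A := 4 * a * c - b ^ 2 - 8 * a ^ 2 * q with hAdef
  have key : 4 * a * A * (a * u ^ 4 + b * u ^ 3 + c * u ^ 2 + d * u + e) =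
      A * (2 * a * u ^ 2 + b * u + 2 * a * q) ^ 2 + (A * u + 2 * a * (d - b * q)) ^ 2
        + 4 * a * (A * (e - a * q ^ 2) - a * (d - b * q) ^ 2) := by
    rw [hAdef]; ring
  have hpos : 0 < 4 * a * A * (a * u ^ 4 + b * u ^ 3 + c * u ^ 2 + d * u + e) := by
    rw [key]
    have := mul_pos (mul_pos four_pos ha) (sub_pos.2 hD)
    positivity
  exact pos_of_mul_pos_right hpos (by positivity)

lemma gegenbauerOctic_add_pos {n d : ℝ} (q : ℝ) (hn : 0 ≤ n)
    (hA : 0 < 4 * ((n + 12) * (n + 10) * (n + 8) * (n + 6)) * (210 * (n + 8) * (n + 6))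
      - (28 * (n + 10) * (n + 8) * (n + 6)) ^ 2
      - 8 * ((n + 12) * (n + 10) * (n + 8) * (n + 6)) ^ 2 * q)
    (hD : (n + 12) * (n + 10) * (n + 8) * (n + 6) *
        (28 * (n + 10) * (n + 8) * (n + 6) * q - 420 * (n + 6)) ^ 2 <
      (4 * ((n + 12) * (n + 10) * (n + 8) * (n + 6)) * (210 * (n + 8) * (n + 6))
        - (28 * (n + 10) * (n + 8) * (n + 6)) ^ 2
        - 8 * ((n + 12) * (n + 10) * (n + 8) * (n + 6)) ^ 2 * q) *
      (105 + d - (n + 12) * (n + 10) * (n + 8) * (n + 6) * q ^ 2)) (u : ℝ) :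
    0 < gegenbauerOctic n u + d := by
  have := quartic_pos (a := (n + 12) * (n + 10) * (n + 8) * (n + 6))
    (b := -(28 * (n + 10) * (n + 8) * (n + 6))) (c := 210 * (n + 8) * (n + 6))
    (d := -(420 * (n + 6))) (e := 105 + d) (q := q) (by positivity)
    (by linarith) (by linarith) u
  unfold gegenbauerOctic
  linarith

/-- The added constant is `G(1) / (n(n+1)/2 - 1)`. -/
lemma gegenbauerOctic_add_pos_of_twenty_le {n : ℝ} (hn : 20 ≤ n) (u : ℝ) :
    0 < gegenbauerOctic n u + 2 * (n + 1) * (n + 3) * (n + 5) / (n + 2) := by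
  obtain ⟨m, hm, rfl⟩ : ∃ m : ℝ, 0 ≤ m ∧ n = m + 20 := ⟨n - 20, by linarith, by ring⟩
  -- In terms of `n`, `q = (7n+100) / ((n+10)(n+12)²)`: the factor `56n + 2240` of `4ac - b²` loses
  -- its `n`-term and becomes `1440`. The shift by 20 makes the final inequality visible to
  -- `positivity`.
  have h1 : 4 * ((m + 20 + 12) * (m + 20 + 10) * (m + 20 + 8) * (m + 20 + 6)) *
        (210 * (m + 20 + 8) * (m + 20 + 6))
      - (28 * (m + 20 + 10) * (m + 20 + 8) * (m + 20 + 6)) ^ 2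
      - 8 * ((m + 20 + 12) * (m + 20 + 10) * (m + 20 + 8) * (m + 20 + 6)) ^ 2 *
        ((7 * m + 240) / ((m + 30) * (m + 32) ^ 2)) =
      1440 * (m + 30) * (m + 28) ^ 2 * (m + 26) ^ 2 := by
    field_simp; ring
  refine gegenbauerOctic_add_pos ((7 * m + 240) / ((m + 30) * (m + 32) ^ 2)) (by linarith) ?_ ?_ u
  · rw [h1]; positivity
  · rw [h1, ← sub_pos]
    field_simp
    ring_nf
    positivity

/-! ### The bound `b` and the minimum of the quartic -/

lemma exists_isMinOn_gegenbauerOctic {n : ℕ} (hn : 3 ≤ n) :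
    ∃ v ∈ Set.Icc (0 : ℝ) 1, (∀ u ∈ Set.Icc (0 : ℝ) 1, gegenbauerOctic n v ≤ gegenbauerOctic n u) ∧
      gegenbauerOctic n v < 0 ∧
      harmonicIndexB n 8 = 1 + gegenbauerOctic n 1 / -gegenbauerOctic n v := by
  have hn' : (3 : ℝ) ≤ n := by exact_mod_cast hn
  have hcont : Continuous (gegenbauerOctic n) := by unfold gegenbauerOctic; fun_prop
  obtain ⟨v, hv, hmin⟩ := isCompact_Icc.exists_isMinOn
    (Set.nonempty_Icc.2 (zero_le_one' ℝ)) hcont.continuousOn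
  have hmin' : ∀ u ∈ Set.Icc (0 : ℝ) 1, gegenbauerOctic n v ≤ gegenbauerOctic n u :=
    fun u hu => hmin hu
  have hneg : gegenbauerOctic n v < 0 := by
    -- A trial point, not the minimiser; only the negative value there matters.
    have hmem : (12 : ℝ) / (n + 12) ∈ Set.Icc (0 : ℝ) 1 :=
      ⟨by positivity, by rw [div_le_one (by positivity)]; linarith⟩
    refine (hmin' _ hmem).trans_lt ?_
    obtain ⟨m, hm, hnm⟩ : ∃ m : ℝ, 0 ≤ m ∧ (n : ℝ) = m + 3 := ⟨n - 3, by linarith, by ring⟩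
    rw [hnm, gegenbauerOctic, ← neg_pos]
    field_simp
    ring_nf
    positivity
  refine ⟨v, hv, hmin', hneg, ?_⟩
  set K : ℝ := (n : ℝ) * (n + 2) * (n + 4) * (n + 14) / 40320 with hK
  have hKpos : 0 < K := by positivity
  have heval : ∀ x : ℝ, (gegenbauerQ n 8).eval x = K * gegenbauerOctic n (x ^ 2) :=
    eval_gegenbauerQ_eight n hn
  have hc : harmonicIndexC n 8 = K * -gegenbauerOctic n v := by
    have : IsLeast ((fun x : ℝ => (gegenbauerQ n 8).eval x) '' Set.Icc (-1) 1)
        (K * gegenbauerOctic n v) := by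
      refine ⟨⟨√v, ⟨by linarith [Real.sqrt_nonneg v], Real.sqrt_le_one.2 hv.2⟩, ?_⟩, ?_⟩
      · simp only [heval, Real.sq_sqrt hv.1]
      · rintro _ ⟨x, hx, rfl⟩
        simp only [heval]
        have : x ^ 2 ∈ Set.Icc (0 : ℝ) 1 := ⟨sq_nonneg x,
          by rw [sq_le_one_iff_abs_le_one]; exact abs_le.2 hx⟩
        exact mul_le_mul_of_nonneg_left (hmin' _ this) hKpos.le
    rw [harmonicIndexC, this.csInf_eq]; ring
  rw [harmonicIndexB, hc, heval, one_pow, mul_div_mul_left _ _ hKpos.ne']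

lemma lt_harmonicIndexB {n : ℕ} (hn : 3 ≤ n) {B : ℝ} (hB : 1 < B)
    (h : ∀ u, 0 < gegenbauerOctic n u + gegenbauerOctic n 1 / (B - 1)) :
    B < harmonicIndexB n 8 := by
  obtain ⟨v, -, -, hneg, hb⟩ := exists_isMinOn_gegenbauerOctic hn
  have hv := h v
  have hB' : 0 < B - 1 := by linarith
  rw [hb, ← sub_lt_iff_lt_add', lt_div_iff₀ (neg_pos.2 hneg), ← lt_div_iff₀' hB']
  linarith

/-- One sample value bounds the minimum from above, whereas a lower bound on `b` needs positivity
everywhere. -/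
lemma harmonicIndexB_lt {n : ℕ} (hn : 3 ≤ n) {B u : ℝ} (hB : 1 < B) (hu : u ∈ Set.Icc (0 : ℝ) 1)
    (h : gegenbauerOctic n u < -(gegenbauerOctic n 1 / (B - 1))) :
    harmonicIndexB n 8 < B := by
  obtain ⟨v, -, hmin, hneg, hb⟩ := exists_isMinOn_gegenbauerOctic hn
  have hv := hmin u hu
  have hB' : 0 < B - 1 := by linarith
  rw [hb, ← lt_sub_iff_add_lt', div_lt_iff₀ (neg_pos.2 hneg), ← div_lt_iff₀' hB']
  linarith

lemma choose_lt_harmonicIndexB {n : ℕ} (hn : 20 ≤ n) :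
    (n : ℝ) * (n + 1) / 2 < harmonicIndexB n 8 := by
  have hn' : (20 : ℝ) ≤ n := by exact_mod_cast hn
  refine lt_harmonicIndexB (by linarith) (by nlinarith) fun u => ?_
  have key := gegenbauerOctic_add_pos_of_twenty_le hn' u
  have h1 : (n : ℝ) - 1 ≠ 0 := by linarith
  have : gegenbauerOctic n 1 / ((n : ℝ) * (n + 1) / 2 - 1) =
      2 * (n + 1) * (n + 3) * (n + 5) / (n + 2) := by
    rw [gegenbauerOctic_one, show (n : ℝ) * (n + 1) / 2 - 1 = (n - 1) * (n + 2) / 2 by ring]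
    field_simp
  rwa [this]

lemma harmonicIndexB_ne_intCast {n : ℕ} (hn : 3 ≤ n) (hn' : n ≤ 19) (m : ℤ) :
    harmonicIndexB n 8 ≠ m := by
  suffices h : ∃ K : ℤ, (K : ℝ) < harmonicIndexB n 8 ∧ harmonicIndexB n 8 < K + 1 by
    obtain ⟨K, h1, h2⟩ := h
    intro h
    rw [h] at h1 h2
    norm_cast at h1 h2
    omega
  -- `K` is the floor of `b`: the sample point `u`, near the minimiser, certifies `b < K + 1`, and
  -- the shift `q` in `quartic_pos` certifies `K < b`.
  have aux : ∀ (K : ℤ) (u q : ℝ), 1 < K → u ∈ Set.Icc (0 : ℝ) 1 →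
      gegenbauerOctic n u < -(gegenbauerOctic n 1 / K) →
      0 < 4 * (((n : ℝ) + 12) * (n + 10) * (n + 8) * (n + 6)) * (210 * (n + 8) * (n + 6))
        - (28 * (n + 10) * (n + 8) * (n + 6)) ^ 2
        - 8 * ((n + 12) * (n + 10) * (n + 8) * (n + 6)) ^ 2 * q →
      ((n : ℝ) + 12) * (n + 10) * (n + 8) * (n + 6) *
          (28 * (n + 10) * (n + 8) * (n + 6) * q - 420 * (n + 6)) ^ 2 <
        (4 * ((n + 12) * (n + 10) * (n + 8) * (n + 6)) * (210 * (n + 8) * (n + 6))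
          - (28 * (n + 10) * (n + 8) * (n + 6)) ^ 2
          - 8 * ((n + 12) * (n + 10) * (n + 8) * (n + 6)) ^ 2 * q) *
        (105 + gegenbauerOctic n 1 / (K - 1) - (n + 12) * (n + 10) * (n + 8) * (n + 6) * q ^ 2) →
      ∃ K : ℤ, (K : ℝ) < harmonicIndexB n 8 ∧ harmonicIndexB n 8 < K + 1 := by
    intro K u q hK hu h1 hA hD
    have hK' : (1 : ℝ) < K := by exact_mod_cast hK
    exact ⟨K, lt_harmonicIndexB hn hK' (gegenbauerOctic_add_pos q n.cast_nonneg hA hD),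
      harmonicIndexB_lt hn (by linarith) hu (by rwa [add_sub_cancel_right])⟩
  interval_cases n
  · apply aux 3 (3/4) (1/10) <;> norm_num [gegenbauerOctic]
  · apply aux 5 (3/4) (1/12) <;> norm_num [gegenbauerOctic]
  · apply aux 8 (3/4) (1/15) <;> norm_num [gegenbauerOctic]
  · apply aux 11 (2/3) (1/18) <;> norm_num [gegenbauerOctic]
  · apply aux 15 (2/3) (1/21) <;> norm_num [gegenbauerOctic]
  · apply aux 20 (5/8) (1/24) <;> norm_num [gegenbauerOctic]
  · apply aux 27 (3/5) (1/29) <;> norm_num [gegenbauerOctic]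
  · apply aux 34 (4/7) (1/33) <;> norm_num [gegenbauerOctic]
  · apply aux 43 (4/7) (1/38) <;> norm_num [gegenbauerOctic]
  · apply aux 53 (6/11) (1/42) <;> norm_num [gegenbauerOctic]
  · apply aux 66 (8/15) (1/50) <;> norm_num [gegenbauerOctic]
  · apply aux 80 (1/2) (1/56) <;> norm_num [gegenbauerOctic]
  · apply aux 96 (11/23) (1/63) <;> norm_num [gegenbauerOctic]
  · apply aux 114 (7/15) (1/69) <;> norm_num [gegenbauerOctic]
  · apply aux 135 (5/11) (1/78) <;> norm_num [gegenbauerOctic]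
  · apply aux 158 (4/9) (1/85) <;> norm_num [gegenbauerOctic]
  · apply aux 185 (3/7) (1/98) <;> norm_num [gegenbauerOctic]

/-! ### Uniqueness of the minimiser -/

/-- The minimum on `[0, 1]` is attained only once. -/
lemma gegenbauerOctic_isMinOn_unique {n a b : ℝ} (hn : 3 ≤ n)
    (ha : a ∈ Set.Icc (0 : ℝ) 1) (hb : b ∈ Set.Icc (0 : ℝ) 1)
    (hmin : ∀ u ∈ Set.Icc (0 : ℝ) 1, gegenbauerOctic n a ≤ gegenbauerOctic n u)
    (hneg : gegenbauerOctic n a < 0) (hab : gegenbauerOctic n b = gegenbauerOctic n a) :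
    b = a := by
  -- The quartic is positive at 0 and 1, so minimisers are interior and critical.
  have deriv_zero : ∀ c ∈ Set.Icc (0 : ℝ) 1, gegenbauerOctic n c = gegenbauerOctic n a →
      4 * ((n + 12) * (n + 10) * (n + 8) * (n + 6)) * c ^ 3
        - 3 * (28 * (n + 10) * (n + 8) * (n + 6)) * c ^ 2
        + 2 * (210 * (n + 8) * (n + 6)) * c - 420 * (n + 6) = 0 := by
    intro c hc hca
    have h0 : c ≠ 0 := by
      rintro rfl
      norm_num [gegenbauerOctic] at hca hneg
      linarith
    have h1 : c ≠ 1 := by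
      rintro rfl
      have : 0 < (n - 1) * (n + 1) * (n + 3) * (n + 5) := by
        have : 0 < n - 1 := by linarith
        positivity
      rw [gegenbauerOctic_one] at hca
      linarith
    have hloc : IsLocalMin (gegenbauerOctic n) c := by
      filter_upwards [Icc_mem_nhds (lt_of_le_of_ne hc.1 h0.symm) (lt_of_le_of_ne hc.2 h1)] with u hu
      rw [hca]
      exact hmin u hu
    refine hloc.hasDerivAt_eq_zero ?_
    have := ((((hasDerivAt_pow 4 c).const_mul ((n + 12) * (n + 10) * (n + 8) * (n + 6))).sub
      ((hasDerivAt_pow 3 c).const_mul (28 * (n + 10) * (n + 8) * (n + 6)))).add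
      ((hasDerivAt_pow 2 c).const_mul (210 * (n + 8) * (n + 6)))).sub
      ((hasDerivAt_id c).const_mul (420 * (n + 6)))|>.add_const 105
    exact this.congr_deriv (by push_cast; ring)
  by_contra hne
  have hd : b - a ≠ 0 := sub_ne_zero.2 hne
  have hp6 : n + 6 ≠ 0 := by linarith
  have ea := deriv_zero a ha rfl
  have eb := deriv_zero b hb hab
  unfold gegenbauerOctic at hab
  -- Two minimisers would make the quartic symmetric about their midpoint, where its third
  -- derivative vanishes; this is the trapezoidal rule's error term.
  have hs : (n + 12) * (a + b) = 14 := by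
    have : (b - a) ^ 3 * ((n + 10) * (n + 8) * (n + 6)) * ((n + 12) * (a + b) - 14) = 0 := by
      linear_combination (b - a) / 2 * (ea + eb) - hab
    have hp10 : n + 10 ≠ 0 := by linarith
    have := (mul_eq_zero.1 this).resolve_left (by positivity)
    linarith
  -- By that symmetry `7/(n+12)` is also critical, which amounts to `(n+6)(n+5)(n-2) = 0`. The
  -- exception `n = 2` is the Chebyshev case, with two minima in `u`.
  have : (n + 6) * (n ^ 2 + 3 * n - 10) = 0 := by
    linear_combination (-1 / 448) * ((n + 12) ^ 2 * (ea + eb) - (n + 6) *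
      (4 * (n + 10) * (n + 8) * ((n + 12) ^ 2 * (a + b) ^ 2 + 14 * ((n + 12) * (a + b)) + 196
        - 3 * (n + 12) ^ 2 * (a * b)) - 84 * (n + 10) * (n + 8) * ((n + 12) * (a + b) + 14)
        + 420 * (n + 8) * (n + 12)) * hs)
  have := (mul_eq_zero.1 this).resolve_left hp6
  nlinarith

/-! ### Zonal harmonics and equiangular lines -/

/-- The zonal form `Σ a_k L^{8-2k} R^k` with pole `y`, where `L = ⟨y, X⟩` and `R = ⟨X, X⟩`. -/
noncomputable def zonalOctic {n : ℕ} (y : Fin n → ℝ) : MvPolynomial (Fin n) ℝ :=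
  let L : MvPolynomial (Fin n) ℝ := ∑ i, MvPolynomial.C (y i) * MvPolynomial.X i
  let R : MvPolynomial (Fin n) ℝ := ∑ i, MvPolynomial.X i ^ 2
  let N : MvPolynomial (Fin n) ℝ := n
  (N + 12) * (N + 10) * (N + 8) * (N + 6) * L ^ 8
    - 28 * (N + 10) * (N + 8) * (N + 6) * (L ^ 6 * R)
    + 210 * (N + 8) * (N + 6) * (L ^ 4 * R ^ 2) - 420 * (N + 6) * (L ^ 2 * R ^ 3) + 105 * R ^ 4

lemma isHarmonicForm_zonalOctic {n : ℕ} {y : Fin n → ℝ} (hy : ∑ i, y i ^ 2 = 1) :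
    IsHarmonicForm 8 (zonalOctic y) := by
  have hL : (∑ i, MvPolynomial.C (y i) * MvPolynomial.X i :
      MvPolynomial (Fin n) ℝ).IsHomogeneous 1 :=
    MvPolynomial.IsHomogeneous.sum _ _ _ fun i _ => MvPolynomial.isHomogeneous_C_mul_X _ _
  have hR : (∑ i, MvPolynomial.X i ^ 2 : MvPolynomial (Fin n) ℝ).IsHomogeneous 2 :=
    MvPolynomial.IsHomogeneous.sum _ _ _ fun i _ => MvPolynomial.isHomogeneous_X_pow i 2
  have hdL : ∀ i, MvPolynomial.pderiv i (∑ i, MvPolynomial.C (y i) * MvPolynomial.X i :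
      MvPolynomial (Fin n) ℝ) = MvPolynomial.C (y i) := by
    intro i
    simp [MvPolynomial.pderiv_X, Pi.single_apply]
  have hdR : ∀ i, MvPolynomial.pderiv i (∑ i, MvPolynomial.X i ^ 2 :
      MvPolynomial (Fin n) ℝ) = 2 * MvPolynomial.X i := by
    intro i
    simp [Derivation.leibniz_pow, MvPolynomial.pderiv_X, Pi.single_apply]
  have hy' : (∑ i, MvPolynomial.C (y i) ^ 2 : MvPolynomial (Fin n) ℝ) = 1 := by
    simp only [← map_pow, ← map_sum, hy, map_one]
  constructor
  · have hC : ∀ (r : ℝ) {p : MvPolynomial (Fin n) ℝ}, p.IsHomogeneous 8 →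
        (MvPolynomial.C r * p).IsHomogeneous 8 := fun r p hp => by
      simpa using (MvPolynomial.isHomogeneous_C (Fin n) r).mul hp
    have h := ((((hC ((n + 12) * (n + 10) * (n + 8) * (n + 6)) (hL.pow 8)).sub
      (hC (28 * (n + 10) * (n + 8) * (n + 6)) ((hL.pow 6).mul hR))).add
      (hC (210 * (n + 8) * (n + 6)) ((hL.pow 4).mul (hR.pow 2)))).sub
      (hC (420 * (n + 6)) ((hL.pow 2).mul (hR.pow 3)))).add (hC 105 (hR.pow 4))
    have hCnum : ∀ (k : ℕ) [k.AtLeastTwo],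
        (MvPolynomial.C (OfNat.ofNat k) : MvPolynomial (Fin n) ℝ) = OfNat.ofNat k :=
      fun k _ => map_ofNat MvPolynomial.C k
    simpa [zonalOctic, hCnum] using h
  unfold zonalOctic
  dsimp only
  set L : MvPolynomial (Fin n) ℝ := ∑ i, MvPolynomial.C (y i) * MvPolynomial.X i with hLdef
  set R : MvPolynomial (Fin n) ℝ := ∑ i, MvPolynomial.X i ^ 2 with hRdef
  set c0 : MvPolynomial (Fin n) ℝ := (n + 12) * (n + 10) * (n + 8) * (n + 6) with hc0
  set c1 : MvPolynomial (Fin n) ℝ := 28 * (n + 10) * (n + 8) * (n + 6) with hc1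
  set c2 : MvPolynomial (Fin n) ℝ := 210 * (n + 8) * (n + 6) with hc2
  set c3 : MvPolynomial (Fin n) ℝ := 420 * (n + 6) with hc3
  have hnum : ∀ (i : Fin n) (k : ℕ) [k.AtLeastTwo],
      MvPolynomial.pderiv i (OfNat.ofNat k : MvPolynomial (Fin n) ℝ) = 0 := fun i k _ =>
    Derivation.map_natCast _ k
  have hd0 : ∀ i, MvPolynomial.pderiv i c0 = 0 := fun i => by simp [hc0, hnum]
  have hd1 : ∀ i, MvPolynomial.pderiv i c1 = 0 := fun i => by simp [hc1, hnum]
  have hd2 : ∀ i, MvPolynomial.pderiv i c2 = 0 := fun i => by simp [hc2, hnum]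
  have hd3 : ∀ i, MvPolynomial.pderiv i c3 = 0 := fun i => by simp [hc3, hnum]
  -- Sorted by dependence on `i`: summing over `i` turns the four prefactors into `1`, `L`, `R` and
  -- `n`, and the coefficients then cancel.
  have key : ∀ i, MvPolynomial.pderiv i (MvPolynomial.pderiv i
      (c0 * L ^ 8 - c1 * (L ^ 6 * R) + c2 * (L ^ 4 * R ^ 2) - c3 * (L ^ 2 * R ^ 3)
        + 105 * R ^ 4)) =
      MvPolynomial.C (y i) ^ 2 *
        (56 * c0 * L ^ 6 - 30 * c1 * L ^ 4 * R + 12 * c2 * L ^ 2 * R ^ 2 - 2 * c3 * R ^ 3)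
      + MvPolynomial.C (y i) * MvPolynomial.X i *
        (-24 * c1 * L ^ 5 + 32 * c2 * L ^ 3 * R - 24 * c3 * L * R ^ 2)
      + MvPolynomial.X i ^ 2 * (8 * c2 * L ^ 4 - 24 * c3 * L ^ 2 * R + 105 * 48 * R ^ 2)
      + (-2 * c1 * L ^ 6 + 4 * c2 * L ^ 4 * R - 6 * c3 * L ^ 2 * R ^ 2 + 840 * R ^ 3) := by
    intro i
    simp [Derivation.leibniz, Derivation.leibniz_pow, hdL, hdR, hd0, hd1, hd2, hd3, hnum,
      MvPolynomial.pderiv_X]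
    ring
  simp only [key, Finset.sum_add_distrib, ← Finset.sum_mul, hy', ← hLdef, ← hRdef,
    Finset.sum_const, Finset.card_univ, Fintype.card_fin, nsmul_eq_mul]
  rw [hc0, hc1, hc2, hc3]
  ring

lemma eval_zonalOctic {n : ℕ} (x y : EuclideanSpace ℝ (Fin n)) (hx : ‖x‖ = 1) :
    MvPolynomial.eval (fun i => x i) (zonalOctic fun i => y i) =
      gegenbauerOctic n (inner ℝ x y ^ 2) := by
  have h1 : ∑ i, y i * x i = inner ℝ x y := by simp [PiLp.inner_apply]
  have h2 : ∑ i, x i ^ 2 = 1 := by rw [← EuclideanSpace.real_norm_sq_eq, hx, one_pow]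
  simp [zonalOctic, gegenbauerOctic, h1, h2]
  ring

/-- The absolute bound for equiangular lines. -/
lemma card_le_of_inner_sq_eq {n : ℕ} {Y : Finset (EuclideanSpace ℝ (Fin n))} {a : ℝ}
    (ha : 0 ≤ a) (ha' : a < 1) (hY : ∀ y ∈ Y, ‖y‖ = 1)
    (hinner : ∀ x ∈ Y, ∀ y ∈ Y, x ≠ y → inner ℝ x y ^ 2 = a) :
    (Y.card : ℝ) ≤ n * (n + 1) / 2 := by
  -- The symmetric matrix `y yᵀ`, in a space of dimension `n(n+1)/2`. The matrix of squared inner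
  -- products is `(1-a)I + aJ`, nonsingular for `0 ≤ a < 1`, whence independence.
  let φ : EuclideanSpace ℝ (Fin n) → Sym2 (Fin n) → ℝ :=
    fun y => Sym2.lift ⟨fun i j => y i * y j, fun i j => mul_comm _ _⟩
  have hli : LinearIndependent ℝ fun y : Y => φ y := by
    rw [Fintype.linearIndependent_iff]
    intro g hg
    have hg' : ∀ i j, ∑ y : Y, g y * (y.1 i * y.1 j) = 0 := fun i j => by
      simpa [φ] using congrFun hg s(i, j)
    have hsum : ∀ x : Y, ∑ y : Y, g y * inner ℝ x.1 y.1 ^ 2 = 0 := by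
      intro x
      have : ∀ y : Y, g y * inner ℝ x.1 y.1 ^ 2 =
          ∑ i, ∑ j, x.1 i * x.1 j * (g y * (y.1 i * y.1 j)) := by
        intro y
        rw [PiLp.inner_apply, sq, Finset.sum_mul_sum, Finset.mul_sum]
        refine Finset.sum_congr rfl fun i _ => ?_
        rw [Finset.mul_sum]
        refine Finset.sum_congr rfl fun j _ => ?_
        simp only [RCLike.inner_apply, conj_trivial]
        ring
      simp only [this]
      rw [Finset.sum_comm]
      refine Finset.sum_eq_zero fun i _ => ?_
      rw [Finset.sum_comm]
      refine Finset.sum_eq_zero fun j _ => ?_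
      rw [← Finset.mul_sum, hg', mul_zero]
    have hrow : ∀ x : Y, g x * (1 - a) = -(a * ∑ y, g y) := by
      intro x
      have : ∀ y : Y, g y * inner ℝ x.1 y.1 ^ 2 =
          a * g y + if y = x then g y * (1 - a) else 0 := by
        intro y
        split_ifs with h
        · rw [h, real_inner_self_eq_norm_sq, hY x x.2]; ring
        · rw [hinner x x.2 y y.2 fun h' => h (Subtype.ext h'.symm)]; ring
      have h := hsum x
      simp only [this, Finset.sum_add_distrib, ← Finset.mul_sum, Finset.sum_ite_eq',
        Finset.mem_univ, if_true] at h
      linarith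
    have htot : (∑ y, g y) * (1 - a + a * Y.card) = 0 := by
      have h := Finset.sum_congr rfl fun (x : Y) (_ : x ∈ Finset.univ) => hrow x
      rw [← Finset.sum_mul, Finset.sum_const, Finset.card_univ, Fintype.card_coe,
        nsmul_eq_mul] at h
      linarith
    have hpos : 0 < 1 - a + a * Y.card := by
      have : 0 ≤ a * Y.card := by positivity
      linarith
    have hzero := (mul_eq_zero.1 htot).resolve_right hpos.ne'
    intro x
    have h := hrow x
    rw [hzero, mul_zero, neg_zero] at h
    exact (mul_eq_zero.1 h).resolve_right (by linarith)
  have h := hli.fintype_card_le_finrank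
  rw [Module.finrank_fintype_fun_eq_card, Sym2.card, Fintype.card_coe, Fintype.card_fin] at h
  calc (Y.card : ℝ) ≤ ((n + 1).choose 2 : ℕ) := by exact_mod_cast h
    _ = n * (n + 1) / 2 := by rw [Nat.cast_choose_two]; push_cast; ring

lemma IsTightHarmonicIndexDesign.inner_sq_eq {n : ℕ} (hn : 3 ≤ n)
    {Y : Finset (EuclideanSpace ℝ (Fin n))} (hY : IsTightHarmonicIndexDesign 8 Y) :
    ∃ a : ℝ, 0 ≤ a ∧ a < 1 ∧ ∀ x ∈ Y, ∀ y ∈ Y, x ≠ y → inner ℝ x y ^ 2 = a := by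
  have hn' : (3 : ℝ) ≤ n := by exact_mod_cast hn
  obtain ⟨v, hv, hmin, hneg, hb⟩ := exists_isMinOn_gegenbauerOctic hn
  obtain ⟨hdes, hcard⟩ := hY
  have hnorm : ∀ y ∈ Y, ‖y‖ = 1 := fun y hy => by simpa using hdes.subset_sphere y hy
  have hone : 0 < gegenbauerOctic n 1 := by
    have : 0 < (n : ℝ) - 1 := by linarith
    rw [gegenbauerOctic_one]; positivity
  refine ⟨v, hv.1, lt_of_le_of_ne hv.2 (by rintro rfl; linarith), fun x hx y hy hxy => ?_⟩
  have hle : ∀ z ∈ Y, inner ℝ z x ^ 2 ∈ Set.Icc (0 : ℝ) 1 := by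
    intro z hz
    refine ⟨sq_nonneg _, ?_⟩
    have := abs_real_inner_le_norm z x
    rw [hnorm z hz, hnorm x hx, one_mul] at this
    rwa [sq_le_one_iff_abs_le_one]
  have hsum : ∑ z ∈ Y, gegenbauerOctic n (inner ℝ z x ^ 2) = 0 := by
    rw [← hdes.sum_eq_zero _ (isHarmonicForm_zonalOctic (y := fun i => x i)
      (by rw [← EuclideanSpace.real_norm_sq_eq, hnorm x hx, one_pow]))]
    exact Finset.sum_congr rfl fun z hz => (eval_zonalOctic z x (hnorm z hz)).symm
  -- Tightness enters here: `(|Y| - 1)(-min G) = G(1)`, so nonnegative terms sum to zero.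
  have hzero : ∑ z ∈ Y.erase x,
      (gegenbauerOctic n (inner ℝ z x ^ 2) - gegenbauerOctic n v) = 0 := by
    rw [← Finset.add_sum_erase _ _ hx, real_inner_self_eq_norm_sq, hnorm x hx] at hsum
    rw [Finset.sum_sub_distrib, Finset.sum_const, nsmul_eq_mul, Finset.card_erase_of_mem hx,
      Nat.cast_pred (Finset.card_pos.2 ⟨x, hx⟩), hcard, hb]
    have := hneg.ne
    field_simp
    norm_num at hsum
    linarith
  have h := (Finset.sum_eq_zero_iff_of_nonneg fun z hz =>
    sub_nonneg.2 (hmin _ (hle z (Finset.mem_of_mem_erase hz)))).1 hzero y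
      (Finset.mem_erase.2 ⟨hxy.symm, hy⟩)
  rw [real_inner_comm]
  exact gegenbauerOctic_isMinOn_unique hn' hv (hle y hy) hmin hneg (sub_eq_zero.1 h)

theorem mainTheorem2 (n : ℕ) (hn : 3 ≤ n) :
    (¬ ∃ Y : Finset (EuclideanSpace ℝ (Fin n)), IsTightHarmonicIndexDesign 8 Y) ∧
    (20 ≤ n → (n : ℝ) * ((n : ℝ) + 1) / 2 < harmonicIndexB n 8) ∧
    (n ≤ 19 → ∀ m : ℤ, harmonicIndexB n 8 ≠ (m : ℝ)) := by
  refine ⟨?_, choose_lt_harmonicIndexB, fun h m => harmonicIndexB_ne_intCast hn h m⟩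
  rintro ⟨Y, hY⟩
  rcases le_or_gt n 19 with h | h
  · exact harmonicIndexB_ne_intCast hn h Y.card (by rw [← hY.2]; simp)
  · obtain ⟨a, ha, ha', hinner⟩ := hY.inner_sq_eq hn
    have hle := card_le_of_inner_sq_eq ha ha'
      (fun y hy => by simpa using hY.1.subset_sphere y hy) hinner
    rw [hY.2] at hle
    exact hle.not_gt (choose_lt_harmonicIndexB h)
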